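/- Let $M$ be a compact Riemannian manifold without boundary, let $X$ be a $C^1$ vector field on $M$ and let $\phi=(\phi_t)_{t\in\mathbb R}$ be the flow generated by $X$. Let $\Lambda\subset M$ be an attractor of $\phi$, that is, a compact set with an open neighborhood $U$ such that $\phi_t(U)\subset\overline U$ for every $t\ge 0$ and $\Lambda=\bigcap_{t\ge 0}\phi_t(U)$. Assume that $\Lambda$ is $\phi$-invariant ($\phi_t(\Lambda)=\Lambda$ for all $t\in\mathbb R$) and that there is a continuous $D\phi_t$-invariant splitting $T_\Lambda M=E^{cs}\oplus E^{uu}$ with $E^{uu}_x\ne\{0\}$ for every $x\in\Lambda$ such that (i) the splitting is dominated: there are constants $C>0$ and $\lambda>0$ with $$\|D\phi_t|_{E^{cs}_x}\|\cdot\|D\phi_{-t}|_{E^{uu}_{\phi_t(x)}}\|\le C e^{-\lambda t}\qquad\text{for all } t>0,\ x\in\Lambda;$$ (ii) $E^{uu}$ is uniformly expanding: there are constants $C>0$ and $\lambda>0$ with $$\|D\phi_{-t}(v)\|\le C e^{-\lambda t}\|v\|\qquad\text{for all } t>0,\ x\in\Lambda,\ v\in E^{uu}_x.$$ Then $\Lambda$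 contains no singularity of $X$, i.e. $X(\sigma)\neq 0$ for every $\sigma\in\Lambda$. -/

import Mathlib

open Bundle
open scoped Manifold ContDiff Topology

noncomputable section

namespace FlowDynamics

/-- A compact set `Λ` is an attractor of the flow `φ` if it has an open neighborhood `U` such that
`φ_t(U) ⊆ closure U` for all `t ≥ 0` and `Λ = ⋂_{t ≥ 0} φ_t(U)`. -/
def IsAttractor {M : Type*} [TopologicalSpace M] (φ : Flow ℝ M) (Λ : Set M) : Prop :=
  IsCompact Λ ∧ ∃ U : Set M, IsOpen U ∧ Λ ⊆ U ∧
    (∀ t : ℝ, 0 ≤ t → φ t '' U ⊆ closure U) ∧ Λ = ⋂ t : ℝ, ⋂ _ : 0 ≤ t, φ t '' U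

section Manifold

variable {E : Type*} [NormedAddCommGroup E] [NormedSpace ℝ E]
  {H : Type*} [TopologicalSpace H] (I : ModelWithCorners ℝ E H)
  {M : Type*} [TopologicalSpace M] [ChartedSpace H M]

/-- The vector field `X` on `M` is of class `C^1`, as a section of the tangent bundle. -/
def IsC1VectorField [IsManifold I 1 M] (X : (x : M) → TangentSpace I x) : Prop :=
  ContMDiff I I.tangent 1 (fun x ↦ (⟨x, X x⟩ : TangentBundle I M))

/-- The flow `φ` is generated by `X`: each orbit `t ↦ φ_t(x)` is an integral curve of `X`. -/
def IsGeneratedBy (φ : Flow ℝ M) (X : (x : M) → TangentSpace I x) : Prop :=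
  ∀ x : M, IsMIntegralCurve (I := I) (fun t : ℝ ↦ φ t x) X

/-- The family `F x ⊆ T_x M`, `x ∈ Λ`, is a continuous subbundle of `T_Λ M`: near each point of `Λ`
it has a frame of continuous sections over `Λ`. The rank may depend on the point of `Λ`. -/
def IsContinuousSubbundleOn [IsManifold I 1 M] (Λ : Set M)
    (F : (x : M) → Submodule ℝ (TangentSpace I x)) : Prop :=
  ∀ x₀ ∈ Λ, ∃ V ∈ 𝓝 x₀, ∃ (k : ℕ) (s : Fin k → (x : M) → TangentSpace I x),
    (∀ i, ContinuousOn (fun x ↦ (⟨x, s i x⟩ : TangentBundle I M)) (V ∩ Λ)) ∧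
    ∀ x ∈ V ∩ Λ, LinearIndependent ℝ (fun i ↦ s i x) ∧
      Submodule.span ℝ (Set.range fun i ↦ s i x) = F x

/-- The subbundle `F` over `Λ` is invariant under the derivative of the flow:
`Dφ_t (F x) = F (φ_t x)` for all `t ∈ ℝ` and `x ∈ Λ`. -/
def IsDInvariantOn (φ : Flow ℝ M) (Λ : Set M)
    (F : (x : M) → Submodule ℝ (TangentSpace I x)) : Prop :=
  ∀ t : ℝ, ∀ x ∈ Λ,
    (F x).map (mfderiv I I (φ t) x : TangentSpace I x →ₗ[ℝ] TangentSpace I (φ t x)) = F (φ t x)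

variable [RiemannianBundle (fun x : M ↦ TangentSpace I x)]

/-- `T_Λ M = E₁ ⊕ E₂` is a dominated splitting (`E₂` dominates `E₁`) over the invariant set `Λ`.
The norms are operator norms with respect to the Riemannian metric. -/
structure IsDominatedSplitting [IsManifold I 1 M] (φ : Flow ℝ M) (Λ : Set M)
    (E₁ E₂ : (x : M) → Submodule ℝ (TangentSpace I x)) : Prop where
  isCompact : IsCompact Λ
  invariant : ∀ t : ℝ, φ t '' Λ = Λ
  isCompl : ∀ x ∈ Λ, IsCompl (E₁ x) (E₂ x)
  continuous_left : IsContinuousSubbundleOn I Λ E₁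
  continuous_right : IsContinuousSubbundleOn I Λ E₂
  invariant_left : IsDInvariantOn I φ Λ E₁
  invariant_right : IsDInvariantOn I φ Λ E₂
  dominated : ∃ C > (0 : ℝ), ∃ l > (0 : ℝ), ∀ t > (0 : ℝ), ∀ x ∈ Λ,
    ‖(mfderiv I I (φ t) x).comp (E₁ x).subtypeL‖ *
      ‖(mfderiv I I (φ (-t)) (φ t x)).comp (E₂ (φ t x)).subtypeL‖ ≤ C * Real.exp (-l * t)

/-- The bundle `F` over `Λ` is uniformly expanding under the flow. -/
def IsUniformlyExpanding (φ : Flow ℝ M) (Λ : Set M)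
    (F : (x : M) → Submodule ℝ (TangentSpace I x)) : Prop :=
  ∃ C > (0 : ℝ), ∃ l > (0 : ℝ), ∀ t > (0 : ℝ), ∀ x ∈ Λ, ∀ v ∈ F x,
    ‖mfderiv I I (φ (-t)) x v‖ ≤ C * Real.exp (-l * t) * ‖v‖

end Manifold

end FlowDynamics

end

namespace FlowDynamics

/-! Suppose `X σ = 0` with `σ ∈ Λ`. Two facts collide near `σ`.

First, `X` is tangent to `Ecs` along `Λ` (`vectorField_mem_of_bounded`): the derivative of the flow
carries `X x` to `X (φ t x)`, which is bounded by compactness, while a nonzero `Euu`-component would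
grow exponentially and outgrow the `Ecs`-component.

Second, `σ` has a weak strong-unstable set (`exists_unstable_point`): some `y ≠ σ` in the cone
around `Euu σ` has its backward orbit near `σ`, and its `Euu`-coordinate at least halves over
backward time `T`. Since `Λ` is an attractor, this orbit lies in `Λ`
(`IsAttractor.exists_nhds_mem`).

In a chart, the velocity along that orbit is `O(‖z‖)` and lies almost in `Ecs σ`, so over time `T`
the `Euu`-coordinate moves only by a small multiple of `‖z‖` (`norm_map_sub_le_of_velocity`). It
cannot halve unless `z = 0`, that is, `y = σ`. -/

theorem tendsto_const_mul_exp_neg (c : ℝ) {l : ℝ} (hl : 0 < l) :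
    Filter.Tendsto (fun t : ℝ ↦ c * Real.exp (-l * t)) Filter.atTop (𝓝 0) := by
  have : Filter.Tendsto (fun t : ℝ ↦ Real.exp (-(l * t))) Filter.atTop (𝓝 0) :=
    Real.tendsto_exp_neg_atTop_nhds_zero.comp (Filter.tendsto_id.const_mul_atTop hl)
  simpa using this.const_mul c

/-! ### Derivative of the flow along `Λ`, and tangency of `X` to `Ecs`. -/

section Derivative

variable {E : Type*} [NormedAddCommGroup E] [NormedSpace ℝ E]
  {M : Type*} [TopologicalSpace M] [ChartedSpace E M]

theorem mem_of_image_eq {φ : Flow ℝ M} {Λ : Set M} (hinv : ∀ t : ℝ, φ t '' Λ = Λ)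
    (t : ℝ) {x : M} (hx : x ∈ Λ) : φ t x ∈ Λ :=
  hinv t ▸ Set.mem_image_of_mem _ hx

theorem flow_neg_flow (φ : Flow ℝ M) (t : ℝ) (x : M) : φ (-t) (φ t x) = x := by
  rw [← φ.map_add, neg_add_cancel, φ.map_zero_apply]

theorem flow_flow_neg (φ : Flow ℝ M) (t : ℝ) (x : M) : φ t (φ (-t) x) = x := by
  rw [← φ.map_add, add_neg_cancel, φ.map_zero_apply]

/-- Invariance of a nonzero bundle forces the derivative of the flow to exist along `Λ`. -/
theorem IsDInvariantOn.mdifferentiableAt {φ : Flow ℝ M} {Λ : Set M}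
    {F : (x : M) → Submodule ℝ (TangentSpace 𝓘(ℝ, E) x)}
    (hF : IsDInvariantOn 𝓘(ℝ, E) φ Λ F) (hinv : ∀ t : ℝ, φ t '' Λ = Λ)
    (hne : ∀ x ∈ Λ, F x ≠ ⊥) (t : ℝ) {x : M} (hx : x ∈ Λ) :
    MDifferentiableAt 𝓘(ℝ, E) 𝓘(ℝ, E) (φ t) x := by
  by_contra h
  apply hne _ (mem_of_image_eq hinv t hx)
  -- `mfderiv` defaults to `0` where the map is not differentiable, so the image of `F x` would be
  -- `⊥`.
  rw [← hF t x hx, mfderiv_zero_of_not_mdifferentiableAt h]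
  exact Submodule.map_zero _

/-- Differentiate `φ s (φ t x) = φ t (φ s x)` at `s = 0`. -/
theorem mfderiv_flow_apply_vectorField {φ : Flow ℝ M} {X : (x : M) → TangentSpace 𝓘(ℝ, E) x}
    (hφ : IsGeneratedBy 𝓘(ℝ, E) φ X) {t : ℝ} {x : M}
    (hd : MDifferentiableAt 𝓘(ℝ, E) 𝓘(ℝ, E) (φ t) x) :
    mfderiv 𝓘(ℝ, E) 𝓘(ℝ, E) (φ t) x (X x) = X (φ t x) := by
  -- The base point appears as `φ 0 x`, equal to `x` only propositionally; a generic `y` allows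
  -- transport between the tangent spaces.
  have key : ∀ y, y = x → MDifferentiableAt 𝓘(ℝ, E) 𝓘(ℝ, E) (φ t) y := by
    rintro y rfl; exact hd
  have h0 : φ 0 x = x := φ.map_zero_apply x
  have h1 := (key _ h0).hasMFDerivAt.comp (0 : ℝ) (hφ x 0)
  have he : (fun s : ℝ ↦ φ s (φ t x)) = φ t ∘ fun s : ℝ ↦ φ s x := by
    ext s; simp only [Function.comp]; rw [← φ.map_add, ← φ.map_add, add_comm]
  have congr_fun : ∀ (f f' : ℝ → M) (_ : f = f') (A : ℝ →L[ℝ] E),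
      HasMFDerivAt 𝓘(ℝ, ℝ) 𝓘(ℝ, E) f 0 A → HasMFDerivAt 𝓘(ℝ, ℝ) 𝓘(ℝ, E) f' 0 A := by
    rintro f _ rfl A h; exact h
  have h2 := congr_fun _ _ he _ (hφ (φ t x) 0)
  have h3 := hasMFDerivAt_unique h1 h2
  have h4 : (mfderiv 𝓘(ℝ, E) 𝓘(ℝ, E) (φ t) (φ 0 x) ((1 : ℝ) • X (φ 0 x)) : E) =
      (1 : ℝ) • X (φ 0 (φ t x)) := congrArg (fun A : ℝ →L[ℝ] E ↦ A 1) h3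
  rw [one_smul, one_smul] at h4
  have h5 : ∀ y z, y = x → z = φ t x →
      ((mfderiv 𝓘(ℝ, E) 𝓘(ℝ, E) (φ t) y (X y) : E) = X z) →
      mfderiv 𝓘(ℝ, E) 𝓘(ℝ, E) (φ t) x (X x) = X (φ t x) := by
    rintro y z rfl rfl h; exact h
  exact h5 (φ 0 x) (φ 0 (φ t x)) h0 (φ.map_zero_apply _) h4

variable [RiemannianBundle (fun x : M ↦ TangentSpace 𝓘(ℝ, E) x)]

theorem norm_mfderiv_of_eq_id {f : M → M} (hf : f = id) (x : M) (v : TangentSpace 𝓘(ℝ, E) x) :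
    ‖mfderiv 𝓘(ℝ, E) 𝓘(ℝ, E) f x v‖ = ‖v‖ := by
  subst hf
  rw [mfderiv_id]; rfl

theorem norm_mfderiv_flow_neg_apply {φ : Flow ℝ M} {t : ℝ} {x : M}
    (h1 : MDifferentiableAt 𝓘(ℝ, E) 𝓘(ℝ, E) (φ t) x)
    (h2 : MDifferentiableAt 𝓘(ℝ, E) 𝓘(ℝ, E) (φ (-t)) (φ t x)) (v : TangentSpace 𝓘(ℝ, E) x) :
    ‖mfderiv 𝓘(ℝ, E) 𝓘(ℝ, E) (φ (-t)) (φ t x) (mfderiv 𝓘(ℝ, E) 𝓘(ℝ, E) (φ t) x v)‖ = ‖v‖ := by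
  rw [← norm_mfderiv_of_eq_id (f := φ (-t) ∘ φ t) (funext (flow_neg_flow φ t)) x v,
    mfderiv_comp x h2 h1]
  rfl

variable [IsManifold 𝓘(ℝ, E) 1 M]
  {φ : Flow ℝ M} {Λ : Set M} {Ecs Euu : (x : M) → Submodule ℝ (TangentSpace 𝓘(ℝ, E) x)}

/-- Backward contraction is applied to the pushed-forward vector at `φ t x`. -/
theorem IsUniformlyExpanding.exists_le_norm_mfderiv (hdom : IsDominatedSplitting 𝓘(ℝ, E) φ Λ Ecs Euu)
    (hexp : IsUniformlyExpanding 𝓘(ℝ, E) φ Λ Euu) (hne : ∀ x ∈ Λ, Euu x ≠ ⊥) :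
    ∃ C > (0 : ℝ), ∃ l > (0 : ℝ), ∀ t > (0 : ℝ), ∀ x ∈ Λ, ∀ u ∈ Euu x,
      ‖u‖ ≤ C * Real.exp (-l * t) * ‖mfderiv 𝓘(ℝ, E) 𝓘(ℝ, E) (φ t) x u‖ := by
  obtain ⟨C, hC, l, hl, h⟩ := hexp
  refine ⟨C, hC, l, hl, fun t ht x hx u hu ↦ ?_⟩
  have hd := hdom.invariant_right.mdifferentiableAt hdom.invariant hne
  have hx' := mem_of_image_eq hdom.invariant t hx
  rw [← norm_mfderiv_flow_neg_apply (hd t hx) (hd (-t) hx') u]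
  refine h t ht _ hx' _ ?_
  rw [← hdom.invariant_right t x hx]
  exact Submodule.mem_map_of_mem hu

/-- Trades operator norms for vectors, with both derivatives taken forward at `x`. -/
theorem IsDominatedSplitting.exists_norm_mfderiv_mul_le
    (hdom : IsDominatedSplitting 𝓘(ℝ, E) φ Λ Ecs Euu) (hne : ∀ x ∈ Λ, Euu x ≠ ⊥) :
    ∃ C > (0 : ℝ), ∃ l > (0 : ℝ), ∀ t > (0 : ℝ), ∀ x ∈ Λ, ∀ v ∈ Ecs x, ∀ u ∈ Euu x,
      ‖mfderiv 𝓘(ℝ, E) 𝓘(ℝ, E) (φ t) x v‖ * ‖u‖ ≤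
        C * Real.exp (-l * t) * (‖v‖ * ‖mfderiv 𝓘(ℝ, E) 𝓘(ℝ, E) (φ t) x u‖) := by
  obtain ⟨C, hC, l, hl, h⟩ := hdom.dominated
  refine ⟨C, hC, l, hl, fun t ht x hx v hv u hu ↦ ?_⟩
  have hd := hdom.invariant_right.mdifferentiableAt hdom.invariant hne
  have hx' := mem_of_image_eq hdom.invariant t hx
  have hu' : mfderiv 𝓘(ℝ, E) 𝓘(ℝ, E) (φ t) x u ∈ Euu (φ t x) := by
    rw [← hdom.invariant_right t x hx]
    exact Submodule.mem_map_of_mem hu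
  have h1 := ((mfderiv 𝓘(ℝ, E) 𝓘(ℝ, E) (φ t) x).comp (Ecs x).subtypeL).le_opNorm ⟨v, hv⟩
  have h2 := ((mfderiv 𝓘(ℝ, E) 𝓘(ℝ, E) (φ (-t)) (φ t x)).comp (Euu (φ t x)).subtypeL).le_opNorm
    ⟨_, hu'⟩
  have h3 := norm_mfderiv_flow_neg_apply (hd t hx) (hd (-t) hx') u
  change ‖mfderiv 𝓘(ℝ, E) 𝓘(ℝ, E) (φ t) x v‖ ≤ _ * ‖v‖ at h1
  change ‖mfderiv 𝓘(ℝ, E) 𝓘(ℝ, E) (φ (-t)) (φ t x) (mfderiv 𝓘(ℝ, E) 𝓘(ℝ, E) (φ t) x u)‖ ≤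
    _ * ‖mfderiv 𝓘(ℝ, E) 𝓘(ℝ, E) (φ t) x u‖ at h2
  rw [h3] at h2
  refine (mul_le_mul h1 h2 (norm_nonneg _) (by positivity)).trans ?_
  rw [mul_mul_mul_comm]
  exact mul_le_mul_of_nonneg_right (h t ht x hx) (by positivity)

/-- A bounded vector field generating the flow has no component along an expanding,
dominating subbundle. -/
theorem vectorField_mem_of_bounded {X : (x : M) → TangentSpace 𝓘(ℝ, E) x}
    (hφ : IsGeneratedBy 𝓘(ℝ, E) φ X) (hdom : IsDominatedSplitting 𝓘(ℝ, E) φ Λ Ecs Euu)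
    (hexp : IsUniformlyExpanding 𝓘(ℝ, E) φ Λ Euu) (hne : ∀ x ∈ Λ, Euu x ≠ ⊥)
    {B : ℝ} (hB : ∀ x, ‖X x‖ ≤ B) {x : M} (hx : x ∈ Λ) : X x ∈ Ecs x := by
  obtain ⟨C₁, hC₁, l₁, hl₁, h₁⟩ := hexp.exists_le_norm_mfderiv hdom hne
  obtain ⟨C₂, hC₂, l₂, hl₂, h₂⟩ := hdom.exists_norm_mfderiv_mul_le hne
  have hd := hdom.invariant_right.mdifferentiableAt hdom.invariant hne
  have hmem : X x ∈ Ecs x ⊔ Euu x := by rw [(hdom.isCompl x hx).sup_eq_top]; trivial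
  obtain ⟨v, hv, u, hu, hvu⟩ := Submodule.mem_sup.1 hmem
  rcases eq_or_ne u 0 with rfl | hu0
  · rwa [← hvu, add_zero]
  exfalso
  have hupos : 0 < ‖u‖ := norm_pos_iff.2 hu0
  -- For large `t` these give `2 * B < ‖b‖` and `2 * ‖a‖ < ‖b‖`, hence `‖a + b‖ > B`.
  have e₁ := (tendsto_const_mul_exp_neg (2 * C₁ * B) hl₁).eventually_lt_const hupos
  have e₂ := (tendsto_const_mul_exp_neg (2 * C₂ * ‖v‖) hl₂).eventually_lt_const hupos
  obtain ⟨t, ⟨ht₁, ht₂⟩, ht⟩ := ((e₁.and e₂).and (Filter.eventually_gt_atTop 0)).exists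
  have b₁ := h₁ t ht x hx u hu
  have b₂ := h₂ t ht x hx v hv u hu
  have hX := mfderiv_flow_apply_vectorField hφ (hd t hx)
  rw [← hvu, map_add] at hX
  have b₃ := hB (φ t x)
  rw [← hX] at b₃
  set a := mfderiv 𝓘(ℝ, E) 𝓘(ℝ, E) (φ t) x v
  set b := mfderiv 𝓘(ℝ, E) 𝓘(ℝ, E) (φ t) x u
  have b₄ : ‖b‖ ≤ ‖a + b‖ + ‖a‖ := by
    have := norm_sub_le (a + b) a
    rwa [add_sub_cancel_left] at this
  have hb : 0 ≤ ‖b‖ := norm_nonneg _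
  have c₁ : 0 < C₁ * Real.exp (-l₁ * t) := by positivity
  have c₂ : 0 < C₂ * Real.exp (-l₂ * t) := by positivity
  have hbpos : 0 < ‖b‖ := by
    by_contra h0
    have : ‖b‖ = 0 := le_antisymm (not_lt.1 h0) hb
    rw [this, mul_zero] at b₁
    linarith
  have d₁ : 2 * ‖a‖ < ‖b‖ := by
    have : 2 * (‖a‖ * ‖u‖) < ‖u‖ * ‖b‖ := by nlinarith
    nlinarith
  have d₂ : ‖b‖ < 2 * B := by linarith
  nlinarith

end Derivative

/-! ### Compactness arguments for orbits near a fixed point. -/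

section Topology

variable {M : Type*} [TopologicalSpace M]

/-- If near a fixed point `σ` the time-`T` map leaves invariant a closed set `Q` accumulating at `σ`
and doubles a bounded function on it, then some point other than `σ` has its whole
backward `T`-orbit in `Q`. -/
theorem exists_ne_forall_flow_neg_mem (φ : Flow ℝ M) {T : ℝ} {σ : M} (hσ : ∀ t, φ t σ = σ)
    {K Q : Set M} (hK : K ∈ 𝓝 σ) (hQ : IsCompact Q) (hQc : IsClosed Q) {β : M → ℝ} {b : ℝ}
    (hβ : ∀ x ∈ Q, β x ≤ b)
    (hstep : ∀ x ∈ Q, φ T x ∈ K → φ T x ∈ Q ∧ 2 * β x ≤ β (φ T x))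
    (hp : ∀ N ∈ 𝓝 σ, ∃ p ∈ N, p ∈ Q ∧ 0 < β p) :
    ∃ y, y ≠ σ ∧ ∀ n : ℕ, φ (-(n * T)) y ∈ Q := by
  -- Points about to exit after `n` steps inside `Q`. Using `interior K` keeps the sets closed and
  -- excludes `σ` from the intersection.
  let S : ℕ → Set M := fun n ↦ {y | (∀ j ≤ n, φ (-((j : ℕ) * T)) y ∈ Q) ∧ φ T y ∉ interior K}
  have hcont : ∀ t, Continuous (φ t) := φ.continuous_toFun
  have hclosed : ∀ n, IsClosed (S n) := by
    intro n
    have : S n = (⋂ j : ℕ, ⋂ _ : j ≤ n, φ (-((j : ℕ) * T)) ⁻¹' Q) ∩ φ T ⁻¹' (interior K)ᶜ := by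
      ext y; simp [S]
    rw [this]
    exact (isClosed_iInter fun j ↦ isClosed_iInter fun _ ↦ hQc.preimage (hcont _)).inter
      (isOpen_interior.isClosed_compl.preimage (hcont _))
  have hanti : ∀ n, S (n + 1) ⊆ S n := fun n y hy ↦ ⟨fun j hj ↦ hy.1 j (by omega), hy.2⟩
  have hsub : S 0 ⊆ Q := by
    intro y hy
    simpa using hy.1 0 le_rfl
  have hnonempty : ∀ n, (S n).Nonempty := by
    intro n
    -- Starting this close to `σ` delays the exit from `K` beyond step `n`; doubling of the bounded
    -- `β` forces an exit eventually.
    have hN : (⋂ j ∈ Finset.range (n + 1), φ ((j : ℕ) * T) ⁻¹' K) ∈ 𝓝 σ := by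
      refine (Filter.biInter_finset_mem _).2 fun j _ ↦ (hcont _).continuousAt ?_
      rwa [hσ]
    obtain ⟨p, hpN, hpQ, hpβ⟩ := hp _ hN
    simp only [Set.mem_iInter, Finset.mem_range, Set.mem_preimage] at hpN
    have hsucc : ∀ (m : ℕ) (x : M), φ T (φ (m * T) x) = φ ((m + 1 : ℕ) * T) x := by
      intro m x
      rw [← φ.map_add]; congr 1; push_cast; ring
    have iter : ∀ m : ℕ, (∀ j ≤ m, φ ((j : ℕ) * T) p ∈ K) →
        φ (m * T) p ∈ Q ∧ 2 ^ m * β p ≤ β (φ (m * T) p) := by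
      intro m
      induction m with
      | zero => intro _; simpa using hpQ
      | succ m ih =>
        intro h
        obtain ⟨h₁, h₂⟩ := ih fun j hj ↦ h j (by omega)
        have h₃ := hstep _ h₁ (by rw [hsucc]; exact h _ le_rfl)
        rw [hsucc] at h₃
        refine ⟨h₃.1, le_trans ?_ h₃.2⟩
        rw [pow_succ]; linarith
    have hexit : ∃ m : ℕ, φ (m * T) p ∉ K := by
      by_contra! h
      obtain ⟨m, hm⟩ := pow_unbounded_of_one_lt (b / β p) (one_lt_two (α := ℝ))
      have h₁ := iter m fun j _ ↦ h j
      rw [div_lt_iff₀ hpβ] at hm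
      linarith [hβ _ h₁.1]
    classical
    have hm := Nat.find_spec hexit
    have hmin : ∀ j < Nat.find hexit, φ ((j : ℕ) * T) p ∈ K := fun j hj ↦
      not_not.1 (Nat.find_min hexit hj)
    generalize Nat.find hexit = m at hm hmin
    have hmn : n < m := by
      by_contra h
      exact hm (hpN m (by omega))
    obtain ⟨k, rfl⟩ : ∃ k, m = k + 1 := ⟨m - 1, by omega⟩
    refine ⟨φ (k * T) p, fun j hj ↦ ?_, fun h ↦ hm ?_⟩
    · have : φ (-((j : ℕ) * T)) (φ (k * T) p) = φ ((k - j : ℕ) * T) p := by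
        rw [← φ.map_add, Nat.cast_sub (by omega)]; congr 1; ring
      rw [this]
      exact (iter _ fun i hi ↦ hmin i (by omega)).1
    · rw [← hsucc]
      exact interior_subset h
  obtain ⟨y, hy⟩ := IsCompact.nonempty_iInter_of_sequence_nonempty_isCompact_isClosed S hanti
    hnonempty (hQ.of_isClosed_subset (hclosed 0) hsub) hclosed
  rw [Set.mem_iInter] at hy
  refine ⟨y, ?_, fun n ↦ (hy n).1 n le_rfl⟩
  rintro rfl
  apply (hy 0).2
  rw [hσ]
  exact mem_interior_iff_mem_nhds.2 hK

/-- Points whose backward `T`-orbit stays close enough to a fixed point have their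
whole backward orbit close to it. -/
theorem exists_nhds_forall_flow_neg_mem (φ : Flow ℝ M) {T : ℝ} (hT : 0 < T) {σ : M}
    (hσ : ∀ t, φ t σ = σ) {W : Set M} (hW : W ∈ 𝓝 σ) :
    ∃ N ∈ 𝓝 σ, ∀ y, (∀ n : ℕ, φ (-(n * T)) y ∈ N) → ∀ t ≥ 0, φ (-t) y ∈ W := by
  have hnear : ∀ᶠ x in 𝓝 σ, ∀ s ∈ Set.Icc 0 T, φ (-s) x ∈ W := by
    refine isCompact_Icc.eventually_forall_of_forall_eventually fun s _ ↦ ?_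
    have hc : Continuous fun q : M × ℝ ↦ φ (-q.2) q.1 :=
      φ.continuous continuous_snd.neg continuous_fst
    refine hc.continuousAt ?_
    simpa [hσ] using hW
  refine ⟨_, hnear, fun y hy t ht ↦ ?_⟩
  have h := hy ⌊t / T⌋₊ (t - ⌊t / T⌋₊ * T) ⟨?_, ?_⟩
  · rw [← φ.map_add] at h
    convert h using 2
    ring
  · have := Nat.floor_le (div_nonneg ht hT.le)
    rw [le_div_iff₀ hT] at this
    linarith
  · have := Nat.lt_floor_add_one (t / T)
    rw [div_lt_iff₀ hT] at this
    linarith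

/-- Each `y = φ t (φ (-t) y)` then lies in `φ t '' U`. -/
theorem IsAttractor.exists_nhds_mem {φ : Flow ℝ M} {Λ : Set M} (hΛ : IsAttractor φ Λ) {σ : M}
    (hσ : σ ∈ Λ) : ∃ U ∈ 𝓝 σ, ∀ y, (∀ t ≥ 0, φ (-t) y ∈ U) → y ∈ Λ := by
  obtain ⟨-, U, hU, hΛU, -, h⟩ := hΛ
  refine ⟨U, hU.mem_nhds (hΛU hσ), fun y hy ↦ ?_⟩
  rw [h]
  simp only [Set.mem_iInter]
  intro t ht
  refine ⟨φ (-t) y, hy t ht, ?_⟩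
  exact flow_flow_neg φ t y

end Topology

/-! ### Cone, Gronwall and span estimates in the model space. -/

section Linear

variable {E : Type*} [NormedAddCommGroup E] [NormedSpace ℝ E]

/-- A map close to a dominated, expanding linear map preserves the unit cone around the
expanding direction and doubles the expanding coordinate on it. -/
theorem cone_step {P Q L : E →L[ℝ] E} (hPQ : ∀ v, P v + Q v = v)
    (hP : ∀ v, P (L v) = L (P v)) (hQ : ∀ v, Q (L v) = L (Q v))
    (hdom : ∀ v w, ‖L (P v)‖ * ‖Q w‖ ≤ 1 / 8 * (‖P v‖ * ‖L (Q w)‖))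
    (hexp : ∀ w, ‖Q w‖ ≤ 1 / 8 * ‖L (Q w)‖) {ε : ℝ} (hεP : ‖P‖ * ε ≤ 1) (hεQ : ‖Q‖ * ε ≤ 1)
    {z z' : E} (hz : ‖z' - L z‖ ≤ ε * ‖z‖) (hcone : ‖P z‖ ≤ ‖Q z‖) :
    ‖P z'‖ ≤ ‖Q z'‖ ∧ 2 * ‖Q z‖ ≤ ‖Q z'‖ := by
  have hz2 : ‖z‖ ≤ 2 * ‖Q z‖ := by
    have := norm_add_le (P z) (Q z)
    rw [hPQ] at this
    linarith
  have small : ∀ R : E →L[ℝ] E, ‖R‖ * ε ≤ 1 → ‖R z' - R (L z)‖ ≤ 2 * ‖Q z‖ := by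
    intro R hR
    rw [← map_sub]
    calc ‖R (z' - L z)‖ ≤ ‖R‖ * (ε * ‖z‖) :=
          (R.le_opNorm _).trans (mul_le_mul_of_nonneg_left hz (norm_nonneg _))
      _ = ‖R‖ * ε * ‖z‖ := by ring
      _ ≤ 1 * ‖z‖ := mul_le_mul_of_nonneg_right hR (norm_nonneg _)
      _ ≤ _ := by linarith
  have h1 := small P hεP
  have h2 := small Q hεQ
  rw [hP] at h1
  rw [hQ] at h2
  have h3 := hexp z
  have h4 := hdom z z
  have h5 : ‖L (P z)‖ ≤ 1 / 8 * ‖L (Q z)‖ := by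
    rcases (norm_nonneg (Q z)).eq_or_lt' with h | h
    · have : P z = 0 := norm_le_zero_iff.1 (h ▸ hcone)
      rw [this, map_zero, norm_zero]
      positivity
    · refine le_of_mul_le_mul_right ?_ h
      nlinarith [norm_nonneg (L (Q z))]
  have h6 : ‖P z'‖ ≤ ‖L (P z)‖ + 2 * ‖Q z‖ := by
    have := norm_sub_norm_le (P z') (L (P z))
    linarith
  have h7 : ‖L (Q z)‖ - 2 * ‖Q z‖ ≤ ‖Q z'‖ := by
    have := norm_sub_norm_le (L (Q z)) (Q z')
    rw [norm_sub_rev] at this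
    linarith
  -- With `A = ‖L (Q z)‖ ≥ 8 * ‖Q z‖`, each error is at most `A / 4`, so `‖P z'‖ ≤ 3 * A / 8` and
  -- `‖Q z'‖ ≥ 3 * A / 4`.
  constructor <;> linarith [norm_nonneg (L (Q z))]

/-- A curve with linearly bounded velocity whose velocity is nearly in the kernel of `Q` has
almost constant `Q`-coordinate. -/
theorem norm_map_sub_le_of_velocity {Q : E →L[ℝ] E} {c c' : ℝ → E} {T K ε : ℝ} (hT : 0 ≤ T)
    (hK : 0 ≤ K) (hε : 0 ≤ ε) (hc : ∀ s ∈ Set.Icc 0 T, HasDerivAt c (c' s) s)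
    (hbound : ∀ s ∈ Set.Icc 0 T, ‖c' s‖ ≤ K * ‖c s‖)
    (hQ : ∀ s ∈ Set.Icc 0 T, ‖Q (c' s)‖ ≤ ε * ‖c' s‖) :
    ‖Q (c T) - Q (c 0)‖ ≤ ε * (K * (‖c 0‖ * Real.exp (K * T))) * T := by
  -- Gronwall bounds the curve, hence its velocity; the mean value inequality for `Q ∘ c` finishes.
  have hg : ∀ s ∈ Set.Icc 0 T, ‖c s‖ ≤ ‖c 0‖ * Real.exp (K * T) := by
    intro s hs
    have := norm_le_gronwallBound_of_norm_deriv_right_le (f := c) (f' := c') (δ := ‖c 0‖) (K := K)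
      (ε := 0) (a := 0) (b := T) (fun s hs ↦ (hc s hs).continuousAt.continuousWithinAt)
      (fun s hs ↦ (hc s (Set.Ico_subset_Icc_self hs)).hasDerivWithinAt) le_rfl
      (fun s hs ↦ by simpa using hbound s (Set.Ico_subset_Icc_self hs)) s hs
    rw [gronwallBound_ε0, sub_zero] at this
    refine this.trans (mul_le_mul_of_nonneg_left (Real.exp_le_exp.2 ?_) (norm_nonneg _))
    exact mul_le_mul_of_nonneg_left hs.2 hK
  have := norm_image_sub_le_of_norm_deriv_le_segment' (f := fun s ↦ Q (c s))
    (f' := fun s ↦ Q (c' s)) (a := 0) (b := T)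
    (C := ε * (K * (‖c 0‖ * Real.exp (K * T))))
    (fun s hs ↦ (Q.hasFDerivAt.comp_hasDerivAt s (hc s hs)).hasDerivWithinAt)
    (fun s hs ↦ by
      have hs' := Set.Ico_subset_Icc_self hs
      refine (hQ s hs').trans (mul_le_mul_of_nonneg_left ?_ hε)
      exact (hbound s hs').trans (mul_le_mul_of_nonneg_left (hg s hs') hK)) T ⟨hT, le_rfl⟩
  simpa using this

/-- If finitely many vectors converge to a linearly independent family killed by `Q`, then
`Q` is uniformly small on their span. -/
theorem eventually_norm_map_span_le {α : Type*} {l : Filter α} {k : ℕ} {e : α → Fin k → E}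
    {e₀ : Fin k → E} (he : Filter.Tendsto e l (𝓝 e₀)) (hli : LinearIndependent ℝ e₀)
    {Q : E →L[ℝ] E} (hQ : ∀ i, Q (e₀ i) = 0) {ε : ℝ} (hε : 0 < ε) :
    ∀ᶠ x in l, ∀ c : Fin k → ℝ, ‖Q (∑ i, c i • e x i)‖ ≤ ε * ‖∑ i, c i • e x i‖ := by
  obtain ⟨κ, hκ, hanti⟩ : ∃ κ > (0 : ℝ), ∀ c : Fin k → ℝ, ‖c‖ ≤ κ * ‖∑ i, c i • e₀ i‖ := by
    have hinj : (Fintype.linearCombination ℝ e₀).ker = ⊥ :=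
      LinearMap.ker_eq_bot.2 (hli.fintypeLinearCombination_injective)
    obtain ⟨κ, hκ, h⟩ := (Fintype.linearCombination ℝ e₀).exists_antilipschitzWith hinj
    refine ⟨κ, hκ, fun c ↦ ?_⟩
    have := h.le_mul_dist c 0
    simpa [Fintype.linearCombination_apply] using this
  -- As `η → 0` the left side tends to `0` and the right to `ε`. Here `k * η * κ` is the relative
  -- loss in the lower bound when `e₀` is perturbed by `η`.
  obtain ⟨η, hη, hη'⟩ : ∃ η > (0 : ℝ), (‖Q‖ * (k * η)) * κ ≤ ε * (1 - k * η * κ) := by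
    have h : Filter.Tendsto (fun η : ℝ ↦ (‖Q‖ * (k * η)) * κ - ε * (1 - k * η * κ)) (𝓝[>] 0)
        (𝓝 ((‖Q‖ * (k * 0)) * κ - ε * (1 - k * 0 * κ))) :=
      (Continuous.tendsto (by fun_prop) _).mono_left nhdsWithin_le_nhds
    obtain ⟨η, h1, h2⟩ :=
      ((h.eventually_lt_const (u := 0) (by simpa using hε)).and self_mem_nhdsWithin).exists
    exact ⟨η, h2, by linarith⟩
  filter_upwards [(Metric.tendsto_nhds.1 he) η hη] with x hx c
  have hdiff : ‖∑ i, c i • e x i - ∑ i, c i • e₀ i‖ ≤ k * η * ‖c‖ := by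
    rw [← Finset.sum_sub_distrib]
    calc ‖∑ i, (c i • e x i - c i • e₀ i)‖ ≤ ∑ i : Fin k, η * ‖c‖ := by
          refine norm_sum_le_of_le _ fun i _ ↦ ?_
          rw [← smul_sub, norm_smul, mul_comm]
          refine mul_le_mul ?_ (norm_le_pi_norm c i) (norm_nonneg _) hη.le
          rw [← dist_eq_norm]
          exact (dist_le_pi_dist _ _ i).trans hx.le
      _ = k * η * ‖c‖ := by simp; ring
  have h0 : Q (∑ i, c i • e₀ i) = 0 := by simp [map_sum, hQ]
  have h1 : ‖Q (∑ i, c i • e x i)‖ ≤ ‖Q‖ * (k * η * ‖c‖) := by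
    rw [← sub_zero (Q _), ← h0, ← map_sub]
    exact (Q.le_opNorm _).trans (mul_le_mul_of_nonneg_left hdiff (norm_nonneg _))
  have h2 := norm_sub_norm_le (∑ i, c i • e₀ i) (∑ i, c i • e x i)
  rw [norm_sub_rev] at h2
  have h3 := hanti c
  have hk : (0 : ℝ) ≤ k * η := by positivity
  set N₀ := ‖∑ i, c i • e₀ i‖
  have h4 : ‖c‖ * (1 - k * η * κ) ≤ κ * ‖∑ i, c i • e x i‖ := by nlinarith
  refine h1.trans ?_
  have h5 := mul_le_mul_of_nonneg_left hη' (norm_nonneg c)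
  have h6 := mul_le_mul_of_nonneg_left h4 hε.le
  refine le_of_mul_le_mul_right ?_ hκ
  linarith

end Linear

/-! ### The flow, `X` and the subbundles in the chart at `σ`. -/

section Chart

variable {E : Type*} [NormedAddCommGroup E] [NormedSpace ℝ E]
  {M : Type*} [TopologicalSpace M] [ChartedSpace E M]

theorem eventually_norm_chart_sub_le {f : M → M} {σ : M} (hσ : f σ = σ)
    (hd : MDifferentiableAt 𝓘(ℝ, E) 𝓘(ℝ, E) f σ) {L : E →L[ℝ] E}
    (hL : L = mfderiv 𝓘(ℝ, E) 𝓘(ℝ, E) f σ) {ε : ℝ} (hε : 0 < ε) :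
    ∀ᶠ x in 𝓝 σ, ‖(extChartAt 𝓘(ℝ, E) σ (f x) - extChartAt 𝓘(ℝ, E) σ σ) -
        L (extChartAt 𝓘(ℝ, E) σ x - extChartAt 𝓘(ℝ, E) σ σ)‖ ≤
      ε * ‖extChartAt 𝓘(ℝ, E) σ x - extChartAt 𝓘(ℝ, E) σ σ‖ := by
  have h1 := hd.hasMFDerivAt.2
  have h2 : HasFDerivWithinAt (extChartAt 𝓘(ℝ, E) (f σ) ∘ f ∘ (extChartAt 𝓘(ℝ, E) σ).symm) L
      (Set.range 𝓘(ℝ, E)) (extChartAt 𝓘(ℝ, E) σ σ) := by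
    rw [hL]; exact h1
  rw [hσ, modelWithCornersSelf_coe, Set.range_id, hasFDerivWithinAt_univ] at h2
  have h3 := h2.isLittleO.def hε
  have h4 := (continuousAt_extChartAt (I := 𝓘(ℝ, E)) σ).eventually h3
  filter_upwards [h4, extChartAt_source_mem_nhds (I := 𝓘(ℝ, E)) σ] with x hx hxs
  simpa only [Function.comp, extChartAt_to_inv, (extChartAt 𝓘(ℝ, E) σ).left_inv hxs, hσ] using hx

theorem exists_eventually_norm_le_of_mdifferentiableAt {f : M → E} {σ : M} (hσ : f σ = 0)
    (hf : MDifferentiableAt 𝓘(ℝ, E) 𝓘(ℝ, E) f σ) :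
    ∃ K ≥ (0 : ℝ), ∀ᶠ x in 𝓝 σ, ‖f x‖ ≤
      K * ‖extChartAt 𝓘(ℝ, E) σ x - extChartAt 𝓘(ℝ, E) σ σ‖ := by
  obtain ⟨A, h⟩ : ∃ A : E →L[ℝ] E, HasFDerivWithinAt (writtenInExtChartAt 𝓘(ℝ, E) 𝓘(ℝ, E) σ f) A
      (Set.range 𝓘(ℝ, E)) (extChartAt 𝓘(ℝ, E) σ σ) := ⟨_, hf.hasMFDerivAt.2⟩
  rw [modelWithCornersSelf_coe, Set.range_id, hasFDerivWithinAt_univ] at h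
  obtain ⟨K, hK, hO⟩ := h.isBigO_sub.exists_nonneg
  refine ⟨K, hK, ?_⟩
  have hO' := (continuousAt_extChartAt (I := 𝓘(ℝ, E)) σ).eventually hO.bound
  filter_upwards [hO', extChartAt_source_mem_nhds (I := 𝓘(ℝ, E)) σ] with x hx hxs
  simpa only [writtenInExtChartAt, Function.comp, extChartAt_to_inv,
    (extChartAt 𝓘(ℝ, E) σ).left_inv hxs, extChartAt_model_space_eq_id, PartialEquiv.refl_coe,
    id, hσ, sub_zero] using hx

variable [IsManifold 𝓘(ℝ, E) 1 M]

/-- In the trivialization at `σ`, `X` becomes a differentiable `E`-valued map vanishing at `σ`. -/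
theorem exists_eventually_norm_vectorField_le {X : (x : M) → TangentSpace 𝓘(ℝ, E) x}
    (hX : IsC1VectorField 𝓘(ℝ, E) X) {σ : M} (hσ : X σ = 0) :
    ∃ K ≥ (0 : ℝ), ∀ᶠ x in 𝓝 σ, ‖tangentCoordChange 𝓘(ℝ, E) x σ x (X x)‖ ≤
      K * ‖extChartAt 𝓘(ℝ, E) σ x - extChartAt 𝓘(ℝ, E) σ σ‖ := by
  have h1 := (contMDiffAt_section (IB := 𝓘(ℝ, E)) (F := E) (E := TangentSpace 𝓘(ℝ, E)) (n := 1)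
    (s := X) σ).1 (hX σ)
  have h2 : ContMDiffAt 𝓘(ℝ, E) 𝓘(ℝ, E) 1
    (fun x ↦ tangentCoordChange 𝓘(ℝ, E) x σ x (X x)) σ := h1
  refine exists_eventually_norm_le_of_mdifferentiableAt ?_ (h2.mdifferentiableAt one_ne_zero)
  rw [hσ]
  exact map_zero _

/-- In coordinates at `σ` a local frame of `F` converges along `Λ` to a basis of `F σ`, which `Q`
kills. -/
theorem IsContinuousSubbundleOn.eventually_norm_le {Λ : Set M}
    {F : (x : M) → Submodule ℝ (TangentSpace 𝓘(ℝ, E) x)}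
    (hF : IsContinuousSubbundleOn 𝓘(ℝ, E) Λ F) {σ : M} (hσ : σ ∈ Λ) {Q : E →L[ℝ] E}
    (hQ : ∀ v ∈ F σ, Q v = 0) {ε : ℝ} (hε : 0 < ε) :
    ∀ᶠ x in 𝓝 σ, x ∈ Λ → ∀ v ∈ F x, ‖Q (tangentCoordChange 𝓘(ℝ, E) x σ x v)‖ ≤
      ε * ‖tangentCoordChange 𝓘(ℝ, E) x σ x v‖ := by
  obtain ⟨V, hV, k, s, hs, hspan⟩ := hF σ hσ
  have hσV : σ ∈ V ∩ Λ := ⟨mem_of_mem_nhds hV, hσ⟩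
  have hcont : ∀ i, Filter.Tendsto (fun x ↦ tangentCoordChange 𝓘(ℝ, E) x σ x (s i x))
      (𝓝[V ∩ Λ] σ) (𝓝 (s i σ)) := by
    intro i
    have h1 := ((FiberBundle.continuousWithinAt_totalSpace E (E := TangentSpace 𝓘(ℝ, E)) _).1
      (hs i σ hσV)).2
    have h2 : ContinuousWithinAt (fun x ↦ tangentCoordChange 𝓘(ℝ, E) x σ x (s i x))
      (V ∩ Λ) σ := h1
    have h3 : tangentCoordChange 𝓘(ℝ, E) σ σ σ (s i σ) = s i σ :=
      tangentCoordChange_self (mem_extChartAt_source σ)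
    have h4 := h2.tendsto
    rwa [h3] at h4
  have key := eventually_norm_map_span_le (E := E)
    (e := fun x i ↦ tangentCoordChange 𝓘(ℝ, E) x σ x (s i x)) (e₀ := fun i ↦ s i σ)
    (tendsto_pi_nhds.2 hcont) (hspan σ hσV).1 (Q := Q)
    (fun i ↦ hQ _ ((hspan σ hσV).2 ▸ Submodule.subset_span ⟨i, rfl⟩)) hε
  rw [eventually_nhdsWithin_iff] at key
  filter_upwards [key, hV] with x hx hxV hxΛ v hv
  rw [← (hspan x ⟨hxV, hxΛ⟩).2, Submodule.mem_span_range_iff_exists_fun] at hv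
  obtain ⟨c, rfl⟩ := hv
  have hsum : tangentCoordChange 𝓘(ℝ, E) x σ x (∑ i, c i • s i x) =
      ∑ i, c i • tangentCoordChange 𝓘(ℝ, E) x σ x (s i x) := by
    refine (map_sum (tangentCoordChange 𝓘(ℝ, E) x σ x) (fun i ↦ (c i • s i x : E)) _).trans ?_
    exact Finset.sum_congr rfl fun i _ ↦ map_smul _ _ _
  have := hx ⟨hxV, hxΛ⟩ c
  rw [← hsum] at this
  exact this

theorem IsGeneratedBy.hasDerivAt_chart {X : (x : M) → TangentSpace 𝓘(ℝ, E) x} {φ : Flow ℝ M}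
    (hφ : IsGeneratedBy 𝓘(ℝ, E) φ X) {σ y : M} {t : ℝ}
    (ht : φ t y ∈ (extChartAt 𝓘(ℝ, E) σ).source) :
    HasDerivAt (fun s ↦ extChartAt 𝓘(ℝ, E) σ (φ s y))
      (tangentCoordChange 𝓘(ℝ, E) (φ t y) σ (φ t y) (X (φ t y))) t := by
  have hsrc : φ t y ∈ (chartAt E σ).source := by rwa [← extChartAt_source 𝓘(ℝ, E) σ]
  have h1 := HasMFDerivAt.comp t (hasMFDerivAt_extChartAt (I := 𝓘(ℝ, E)) hsrc) (hφ y t)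
  rw [mfderiv_chartAt_eq_tangentCoordChange hsrc] at h1
  have h2 : HasFDerivAt (fun s ↦ extChartAt 𝓘(ℝ, E) σ (φ s y))
      ((tangentCoordChange 𝓘(ℝ, E) (φ t y) σ (φ t y)).comp
        ((1 : ℝ →L[ℝ] ℝ).smulRight (X (φ t y) : E))) t :=
    hasMFDerivAt_iff_hasFDerivAt.1 h1
  have h3 := h2.hasDerivAt
  have h4 : (tangentCoordChange 𝓘(ℝ, E) (φ t y) σ (φ t y) ((1 : ℝ) • (X (φ t y) : E))) =
    tangentCoordChange 𝓘(ℝ, E) (φ t y) σ (φ t y) (X (φ t y)) := by rw [one_smul]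
  rw [← h4]
  exact h3

end Chart

/-! ### Consequences of `X σ = 0`, bounds on `X`, and the linear dynamics at `σ`. -/

section Singularity

variable {E : Type*} [NormedAddCommGroup E] [NormedSpace ℝ E]
  {M : Type*} [TopologicalSpace M] [ChartedSpace E M]

theorem flow_eq_self_of_vectorField_eq_zero [T2Space M] [CompleteSpace E] [IsManifold 𝓘(ℝ, E) 1 M]
    {X : (x : M) → TangentSpace 𝓘(ℝ, E) x} (hX : IsC1VectorField 𝓘(ℝ, E) X) {φ : Flow ℝ M}
    (hφ : IsGeneratedBy 𝓘(ℝ, E) φ X) {σ : M} (hσ : X σ = 0) (t : ℝ) : φ t σ = σ := by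
  have hconst : IsMIntegralCurve (I := 𝓘(ℝ, E)) (fun _ : ℝ ↦ σ) X := by
    intro s
    have : (1 : ℝ →L[ℝ] ℝ).smulRight (X σ) = 0 := by rw [hσ]; ext; simp
    rw [this]
    exact hasMFDerivAt_const σ s
  exact congrFun (isMIntegralCurve_Ioo_eq_of_contMDiff_boundaryless (t₀ := 0) hX (hφ σ) hconst
    (φ.map_zero_apply σ)) t

variable [RiemannianBundle (fun x : M ↦ TangentSpace 𝓘(ℝ, E) x)]

theorem exists_forall_norm_le [CompactSpace M] [IsManifold 𝓘(ℝ, E) 1 M]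
    [IsContinuousRiemannianBundle E (fun x : M ↦ TangentSpace 𝓘(ℝ, E) x)]
    {X : (x : M) → TangentSpace 𝓘(ℝ, E) x} (hX : IsC1VectorField 𝓘(ℝ, E) X) :
    ∃ B, ∀ x, ‖X x‖ ≤ B := by
  have hc : Continuous fun x ↦ (⟨x, X x⟩ : TangentBundle 𝓘(ℝ, E) M) := ContMDiff.continuous hX
  have h : Continuous fun x ↦ inner ℝ (X x) (X x) := Continuous.inner_bundle (F := E) hc hc
  obtain ⟨B, hB⟩ := isCompact_univ.exists_bound_of_continuousOn h.continuousOn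
  refine ⟨√B, fun x ↦ Real.le_sqrt_of_sq_le ?_⟩
  rw [← real_inner_self_eq_norm_sq]
  exact (le_abs_self _).trans (hB x trivial)

/-- The Riemannian norm on a tangent space is equivalent to the norm of the model space. -/
theorem exists_norm_equiv (σ : M) : ∃ c > (0 : ℝ), ∀ v : TangentSpace 𝓘(ℝ, E) σ,
    ‖v‖ ≤ c * ‖(show E from v)‖ ∧ ‖(show E from v)‖ ≤ c * ‖v‖ := by
  let A : TangentSpace 𝓘(ℝ, E) σ →L[ℝ] E := ContinuousLinearMap.id ℝ E
  let B : E →L[ℝ] TangentSpace 𝓘(ℝ, E) σ := ContinuousLinearMap.id ℝ E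
  refine ⟨‖A‖ + ‖B‖ + 1, by positivity, fun v ↦ ⟨?_, ?_⟩⟩
  · refine (B.le_opNorm v).trans (mul_le_mul_of_nonneg_right ?_ (norm_nonneg _))
    linarith [norm_nonneg A]
  · refine (A.le_opNorm v).trans (mul_le_mul_of_nonneg_right ?_ (norm_nonneg _))
    linarith [norm_nonneg B]

variable [IsManifold 𝓘(ℝ, E) 1 M] {φ : Flow ℝ M} {Λ : Set M}
  {Ecs Euu : (x : M) → Submodule ℝ (TangentSpace 𝓘(ℝ, E) x)}

/-- At a fixed point, the derivative of the time-`T` map for large `T` is dominated and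
expanding by an arbitrary factor in the norm of the model space. -/
theorem IsDominatedSplitting.exists_time (hdom : IsDominatedSplitting 𝓘(ℝ, E) φ Λ Ecs Euu)
    (hexp : IsUniformlyExpanding 𝓘(ℝ, E) φ Λ Euu) (hne : ∀ x ∈ Λ, Euu x ≠ ⊥) {σ : M}
    (hσ : σ ∈ Λ) (hfix : ∀ t, φ t σ = σ) {δ : ℝ} (hδ : 0 < δ) :
    ∃ T > 0, ∃ L : E →L[ℝ] E, L = mfderiv 𝓘(ℝ, E) 𝓘(ℝ, E) (φ T) σ ∧
      (∀ v ∈ Ecs σ, L v ∈ Ecs σ) ∧ (∀ u ∈ Euu σ, L u ∈ Euu σ) ∧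
      (∀ v : E, v ∈ Ecs σ → ∀ u : E, u ∈ Euu σ → ‖L v‖ * ‖u‖ ≤ δ * (‖v‖ * ‖L u‖)) ∧
      ∀ u : E, u ∈ Euu σ → ‖u‖ ≤ δ * ‖L u‖ := by
  obtain ⟨C₁, hC₁, l₁, hl₁, h₁⟩ := hexp.exists_le_norm_mfderiv hdom hne
  obtain ⟨C₂, hC₂, l₂, hl₂, h₂⟩ := hdom.exists_norm_mfderiv_mul_le hne
  obtain ⟨c, hc, hnorm⟩ := exists_norm_equiv (E := E) σ
  have hnorm' : ∀ y, y = σ → ∀ v : TangentSpace 𝓘(ℝ, E) y,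
      ‖v‖ ≤ c * ‖(show E from v)‖ ∧ ‖(show E from v)‖ ≤ c * ‖v‖ := by
    rintro y rfl; exact hnorm
  -- Each passage between Riemannian and model norms costs a factor `c`: two for expansion, four for
  -- domination.
  obtain ⟨T, ⟨hT₁, hT₂⟩, hT⟩ := ((((tendsto_const_mul_exp_neg (c * c * C₁) hl₁).eventually_lt_const hδ).and
    ((tendsto_const_mul_exp_neg (c * c * (c * c) * C₂) hl₂).eventually_lt_const hδ)).and
    (Filter.eventually_gt_atTop 0)).exists
  obtain ⟨L, hL⟩ : ∃ L : E →L[ℝ] E, L = mfderiv 𝓘(ℝ, E) 𝓘(ℝ, E) (φ T) σ := ⟨_, rfl⟩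
  have hLn : ∀ v : E, ‖mfderiv 𝓘(ℝ, E) 𝓘(ℝ, E) (φ T) σ v‖ ≤ c * ‖L v‖ ∧
      ‖L v‖ ≤ c * ‖mfderiv 𝓘(ℝ, E) 𝓘(ℝ, E) (φ T) σ v‖ := by
    intro v
    subst hL
    exact hnorm' (φ T σ) (hfix T) _
  have hmem : ∀ F : (x : M) → Submodule ℝ (TangentSpace 𝓘(ℝ, E) x),
      IsDInvariantOn 𝓘(ℝ, E) φ Λ F → ∀ v ∈ F σ, L v ∈ F σ := by
    intro F hF v hv
    have h : mfderiv 𝓘(ℝ, E) 𝓘(ℝ, E) (φ T) σ v ∈ F (φ T σ) := by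
      rw [← hF T σ hσ]; exact Submodule.mem_map_of_mem hv
    have hcast : ∀ y, y = σ → ∀ w : E, w ∈ F y → w ∈ F σ := by
      rintro y rfl w hw; exact hw
    subst hL
    exact hcast _ (hfix T) _ h
  refine ⟨T, hT, L, hL, hmem Ecs hdom.invariant_left, hmem Euu hdom.invariant_right, ?_, ?_⟩
  · intro v hv u hu
    have a₁ := h₂ T hT σ hσ v hv u hu
    have a₂ := (hLn v).2
    have a₃ := (hLn u).1
    have a₄ := (hnorm v).1
    have a₅ := (hnorm u).2
    have a₆ : ‖L v‖ * ‖u‖ ≤ c * c * (C₂ * Real.exp (-l₂ * T) * (c * ‖v‖ * (c * ‖L u‖))) := by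
      refine (mul_le_mul a₂ a₅ (norm_nonneg _) (by positivity)).trans ?_
      rw [mul_mul_mul_comm]
      refine mul_le_mul_of_nonneg_left (a₁.trans ?_) (by positivity)
      exact mul_le_mul_of_nonneg_left (mul_le_mul a₄ a₃ (norm_nonneg _) (by positivity))
        (by positivity)
    calc ‖L v‖ * ‖u‖ ≤ _ := a₆
      _ = c * c * (c * c) * C₂ * Real.exp (-l₂ * T) * (‖v‖ * ‖L u‖) := by ring
      _ ≤ δ * (‖v‖ * ‖L u‖) := by gcongr
  · intro u hu
    have a₁ := h₁ T hT σ hσ u hu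
    have a₃ := (hLn u).1
    have a₅ := (hnorm u).2
    calc ‖u‖ ≤ _ := a₅
      _ ≤ c * (C₁ * Real.exp (-l₁ * T) * (c * ‖L u‖)) := by gcongr; exact a₁.trans (by gcongr)
      _ = c * c * C₁ * Real.exp (-l₁ * T) * ‖L u‖ := by ring
      _ ≤ δ * ‖L u‖ := by gcongr

end Singularity

/-! ### A point on the unstable side of `σ`. -/

section UnstableSet

variable {E : Type*} [NormedAddCommGroup E] [NormedSpace ℝ E]
  {M : Type*} [TopologicalSpace M] [T2Space M] [CompactSpace M] [ChartedSpace E M]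

/-- A weak form of the strong unstable manifold theorem: arbitrarily close to a fixed point with a
dominated expanding direction there is a point other than `σ` in the unstable cone whose
backward orbit stays close to `σ` and contracts. -/
theorem exists_unstable_point (φ : Flow ℝ M) {T : ℝ} {σ : M}
    (hfix : ∀ t, φ t σ = σ) (hd : MDifferentiableAt 𝓘(ℝ, E) 𝓘(ℝ, E) (φ T) σ) {P Q L : E →L[ℝ] E}
    (hL : L = mfderiv 𝓘(ℝ, E) 𝓘(ℝ, E) (φ T) σ) (hPQ : ∀ v, P v + Q v = v)
    (hP : ∀ v, P (L v) = L (P v)) (hQ : ∀ v, Q (L v) = L (Q v))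
    (hdom : ∀ v w, ‖L (P v)‖ * ‖Q w‖ ≤ 1 / 8 * (‖P v‖ * ‖L (Q w)‖))
    (hexp : ∀ w, ‖Q w‖ ≤ 1 / 8 * ‖L (Q w)‖) {u : E} (hu : u ≠ 0) (hPu : P u = 0)
    {N : Set M} (hN : N ∈ 𝓝 σ) :
    ∃ y, y ≠ σ ∧ (∀ n : ℕ, φ (-(n * T)) y ∈ N) ∧
      ‖P (extChartAt 𝓘(ℝ, E) σ y - extChartAt 𝓘(ℝ, E) σ σ)‖ ≤
        ‖Q (extChartAt 𝓘(ℝ, E) σ y - extChartAt 𝓘(ℝ, E) σ σ)‖ ∧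
      2 * ‖Q (extChartAt 𝓘(ℝ, E) σ (φ (-T) y) - extChartAt 𝓘(ℝ, E) σ σ)‖ ≤
        ‖Q (extChartAt 𝓘(ℝ, E) σ y - extChartAt 𝓘(ℝ, E) σ σ)‖ := by
  set ψ := extChartAt 𝓘(ℝ, E) σ with hψ
  obtain ⟨ε, hε, hεP, hεQ⟩ : ∃ ε > (0 : ℝ), ‖P‖ * ε ≤ 1 ∧ ‖Q‖ * ε ≤ 1 := by
    refine ⟨(‖P‖ + ‖Q‖ + 1)⁻¹, by positivity, ?_, ?_⟩ <;>
    · rw [← div_eq_mul_inv, div_le_one (by positivity)]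
      linarith [norm_nonneg P, norm_nonneg Q]
  have hstep : ∀ᶠ x in 𝓝 σ, ‖P (ψ x - ψ σ)‖ ≤ ‖Q (ψ x - ψ σ)‖ →
      ‖P (ψ (φ T x) - ψ σ)‖ ≤ ‖Q (ψ (φ T x) - ψ σ)‖ ∧
        2 * ‖Q (ψ x - ψ σ)‖ ≤ ‖Q (ψ (φ T x) - ψ σ)‖ := by
    filter_upwards [eventually_norm_chart_sub_le (hfix T) hd hL hε] with x hx hcone
    exact cone_step hPQ hP hQ hdom hexp hεP hεQ hx hcone
  obtain ⟨K, hK, hKc, hKsub⟩ := exists_mem_nhds_isClosed_subset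
    (Filter.inter_mem (Filter.inter_mem hN hstep) (extChartAt_source_mem_nhds (I := 𝓘(ℝ, E)) σ))
  have hcont : ContinuousOn (fun x ↦ ψ x - ψ σ) K :=
    ((continuousOn_extChartAt (I := 𝓘(ℝ, E)) σ).mono fun x hx ↦ (hKsub hx).2).sub continuousOn_const
  have hcontQ : ContinuousOn (fun x ↦ ‖Q (ψ x - ψ σ)‖) K :=
    (Q.continuous.comp_continuousOn hcont).norm
  have hclosed : IsClosed {x ∈ K | ‖P (ψ x - ψ σ)‖ ≤ ‖Q (ψ x - ψ σ)‖} :=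
    hKc.isClosed_le (P.continuous.comp_continuousOn hcont).norm hcontQ
  obtain ⟨b, hb⟩ := hKc.isCompact.exists_bound_of_continuousOn hcontQ
  have hQu : Q u = u := by simpa [hPu] using hPQ u
  obtain ⟨y, hyσ, hy⟩ := exists_ne_forall_flow_neg_mem φ hfix hK hclosed.isCompact hclosed
    (β := fun x ↦ ‖Q (ψ x - ψ σ)‖) (b := b) (fun x hx ↦ (le_abs_self _).trans (hb x hx.1))
    (fun x hx hxK ↦ ⟨⟨hxK, ((hKsub hx.1).1.2 hx.2).1⟩, ((hKsub hx.1).1.2 hx.2).2⟩) (by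
      intro V hV
      -- Seeds for the exit argument: points on the chart segment from `σ` in the direction `u`, on
      -- which `P` vanishes and `Q` does not.
      have hline : Filter.Tendsto (fun s : ℝ ↦ ψ σ + s • u) (𝓝[>] 0) (𝓝 (ψ σ)) := by
        have : Filter.Tendsto (fun s : ℝ ↦ ψ σ + s • u) (𝓝 0) (𝓝 (ψ σ + (0 : ℝ) • u)) :=
          Continuous.tendsto (by fun_prop) _
        rw [zero_smul, add_zero] at this
        exact this.mono_left nhdsWithin_le_nhds
      have hsymm : Filter.Tendsto ψ.symm (𝓝 (ψ σ)) (𝓝 σ) := by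
        have := (continuousAt_extChartAt_symm (I := 𝓘(ℝ, E)) σ).tendsto
        rwa [extChartAt_to_inv] at this
      have h1 := (hsymm.comp hline).eventually (Filter.inter_mem hV hK)
      have h2 := hline.eventually (extChartAt_target_mem_nhds (I := 𝓘(ℝ, E)) σ)
      obtain ⟨s, ⟨⟨hs1, hs2⟩, hs3⟩, hs4⟩ := ((h1.and h2).and self_mem_nhdsWithin).exists
      have hz : ψ (ψ.symm (ψ σ + s • u)) - ψ σ = s • u := by
        rw [ψ.right_inv hs3, add_sub_cancel_left]
      refine ⟨_, hs1, ⟨hs2, ?_⟩, ?_⟩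
      · simp only [Function.comp, hz, map_smul, hPu, smul_zero, norm_zero]
        exact norm_nonneg _
      · simp only [Function.comp, hz, map_smul, hQu]
        exact norm_pos_iff.2 (smul_ne_zero (ne_of_gt hs4) hu))
  have h0 : φ (-((0 : ℕ) * T)) y = y := by simp
  have h1 : φ (-((1 : ℕ) * T)) y = φ (-T) y := by simp
  refine ⟨y, hyσ, fun n ↦ (hKsub (hy n).1).1.1, (h0 ▸ hy 0).2, ?_⟩
  -- Doubling at `φ (-T) y`, which is still in the cone, is the required backward contraction.
  have h2 := h1 ▸ hy 1
  have h3 := ((hKsub h2.1).1.2 h2.2).2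
  rwa [flow_flow_neg] at h3

end UnstableSet

end FlowDynamics

/-! ### The contradiction at a singularity. -/

theorem mainTheorem6
    {E : Type*} [NormedAddCommGroup E] [NormedSpace ℝ E] [FiniteDimensional ℝ E]
    {M : Type*} [TopologicalSpace M] [T2Space M] [CompactSpace M]
    [ChartedSpace E M] [IsManifold 𝓘(ℝ, E) ∞ M]
    [RiemannianBundle (fun x : M ↦ TangentSpace 𝓘(ℝ, E) x)]
    [IsContMDiffRiemannianBundle 𝓘(ℝ, E) ∞ E (fun x : M ↦ TangentSpace 𝓘(ℝ, E) x)]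
    (X : (x : M) → TangentSpace 𝓘(ℝ, E) x)
    (hX : FlowDynamics.IsC1VectorField 𝓘(ℝ, E) X)
    (φ : Flow ℝ M) (hφ : FlowDynamics.IsGeneratedBy 𝓘(ℝ, E) φ X)
    (Λ : Set M) (hΛ : FlowDynamics.IsAttractor φ Λ)
    (Ecs Euu : (x : M) → Submodule ℝ (TangentSpace 𝓘(ℝ, E) x))
    (hdom : FlowDynamics.IsDominatedSplitting 𝓘(ℝ, E) φ Λ Ecs Euu)
    (hexp : FlowDynamics.IsUniformlyExpanding 𝓘(ℝ, E) φ Λ Euu)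
    (hne : ∀ x ∈ Λ, Euu x ≠ ⊥) :
    ∀ σ ∈ Λ, X σ ≠ 0 := by
  intro σ hσ hXσ
  have : CompleteSpace E := FiniteDimensional.complete ℝ E
  have : IsContinuousRiemannianBundle E (fun x : M ↦ TangentSpace 𝓘(ℝ, E) x) := by
    obtain ⟨g, hg, hg'⟩ := IsContMDiffRiemannianBundle.exists_contMDiff (IB := 𝓘(ℝ, E)) (n := ∞)
      (F := E) (E := fun x : M ↦ TangentSpace 𝓘(ℝ, E) x)
    exact ⟨g, hg.continuous, hg'⟩
  have hfix := FlowDynamics.flow_eq_self_of_vectorField_eq_zero hX hφ hXσ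
  obtain ⟨B, hB⟩ := FlowDynamics.exists_forall_norm_le hX
  have hXcs : ∀ x ∈ Λ, X x ∈ Ecs x := fun x hx ↦
    FlowDynamics.vectorField_mem_of_bounded hφ hdom hexp hne hB hx
  obtain ⟨T, hT, L, hL, hLcs, hLuu, hLdom, hLexp⟩ :=
    hdom.exists_time hexp hne hσ hfix (δ := 1 / 8) (by norm_num)
  let F : Submodule ℝ E := Ecs σ
  let G : Submodule ℝ E := Euu σ
  have hFG : IsCompl F G := hdom.isCompl σ hσ
  let P : E →L[ℝ] E := LinearMap.toContinuousLinearMap (F.projection G hFG)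
  let Q : E →L[ℝ] E := LinearMap.toContinuousLinearMap (G.projection F hFG.symm)
  have hPmem : ∀ v, P v ∈ F := fun v ↦ Submodule.projection_apply_mem hFG v
  have hQmem : ∀ v, Q v ∈ G := fun v ↦ Submodule.projection_apply_mem hFG.symm v
  have hPF : ∀ v ∈ F, P v = v := fun v hv ↦ Submodule.projection_apply_of_mem_left hFG hv
  have hQG : ∀ v ∈ G, Q v = v := fun v hv ↦ Submodule.projection_apply_of_mem_left hFG.symm hv
  have hPG : ∀ v ∈ G, P v = 0 := fun v hv ↦ Submodule.projection_apply_of_mem_right hFG hv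
  have hQF : ∀ v ∈ F, Q v = 0 := fun v hv ↦ Submodule.projection_apply_of_mem_right hFG.symm hv
  have hPQ : ∀ v, P v + Q v = v := fun v ↦ Submodule.projection_add_projection_eq_self hFG v
  have hPL : ∀ v, P (L v) = L (P v) := by
    intro v
    conv_lhs => rw [← hPQ v, map_add, map_add, hPF _ (hLcs _ (hPmem v)),
      hPG _ (hLuu _ (hQmem v)), add_zero]
  have hQL : ∀ v, Q (L v) = L (Q v) := by
    intro v
    conv_lhs => rw [← hPQ v, map_add, map_add, hQF _ (hLcs _ (hPmem v)),
      hQG _ (hLuu _ (hQmem v)), zero_add]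
  obtain ⟨u, huG, hu⟩ : ∃ u ∈ G, u ≠ 0 := G.ne_bot_iff.1 (hne σ hσ)
  obtain ⟨K, hK, hXK⟩ := FlowDynamics.exists_eventually_norm_vectorField_le hX hXσ
  -- Makes the drift of the `Q`-coordinate over time `T` at most `‖z‖ / 8`; the `+ 1` covers `K =
  -- 0`.
  let ε : ℝ := (8 * (K * Real.exp (K * T) * T + 1))⁻¹
  have hε : 0 < ε := by positivity
  have hcs := hdom.continuous_left.eventually_norm_le hσ hQF hε
  obtain ⟨U, hU, hUΛ⟩ := hΛ.exists_nhds_mem hσ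
  obtain ⟨N, hN, hNW⟩ := FlowDynamics.exists_nhds_forall_flow_neg_mem φ hT hfix
    (Filter.inter_mem (Filter.inter_mem hU (hXK.and hcs))
      (extChartAt_source_mem_nhds (I := 𝓘(ℝ, E)) σ))
  obtain ⟨y, hyσ, hyN, hycone, hycontr⟩ := FlowDynamics.exists_unstable_point φ hfix
    (hdom.invariant_right.mdifferentiableAt hdom.invariant hne T hσ) hL hPQ hPL hQL
    (fun v w ↦ hLdom _ (hPmem v) _ (hQmem w)) (fun w ↦ hLexp _ (hQmem w)) hu (hPG u huG) hN
  have hyW := hNW y hyN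
  have hyΛ : y ∈ Λ := hUΛ y fun t ht ↦ (hyW t ht).1.1
  have hderiv : ∀ s ∈ Set.Icc 0 T, HasDerivAt
      (fun s ↦ extChartAt 𝓘(ℝ, E) σ (φ (-s) y) - extChartAt 𝓘(ℝ, E) σ σ)
      (-(tangentCoordChange 𝓘(ℝ, E) (φ (-s) y) σ (φ (-s) y) (X (φ (-s) y)))) s := by
    intro s hs
    have h1 := (hφ.hasDerivAt_chart (hyW s hs.1).2).scomp s (hasDerivAt_neg s)
    rw [neg_smul, one_smul] at h1
    exact h1.sub_const _
  have key := FlowDynamics.norm_map_sub_le_of_velocity (Q := Q) hT.le hK hε.le hderiv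
    (fun s hs ↦ by rw [norm_neg]; exact (hyW s hs.1).1.2.1)
    (fun s hs ↦ by
      have hmem := FlowDynamics.mem_of_image_eq hdom.invariant (-s) hyΛ
      rw [map_neg, norm_neg, norm_neg]
      exact (hyW s hs.1).1.2.2 hmem _ (hXcs _ hmem))
  simp only [neg_zero, φ.map_zero_apply] at key
  set z := extChartAt 𝓘(ℝ, E) σ y - extChartAt 𝓘(ℝ, E) σ σ with hz
  have hz2 : ‖z‖ ≤ 2 * ‖Q z‖ := by
    have := norm_add_le (P z) (Q z)
    rw [hPQ] at this
    linarith
  have hzsmall : ε * (K * (‖z‖ * Real.exp (K * T))) * T ≤ 1 / 8 * ‖z‖ := by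
    have h1 : ε * (K * Real.exp (K * T) * T) ≤ 1 / 8 := by
      have h0 : 0 ≤ K * Real.exp (K * T) * T := by positivity
      rw [inv_mul_le_iff₀ (by positivity)]
      linarith
    calc _ = ε * (K * Real.exp (K * T) * T) * ‖z‖ := by ring
      _ ≤ _ := mul_le_mul_of_nonneg_right h1 (norm_nonneg _)
  have hrev := norm_sub_norm_le (Q z)
    (Q (extChartAt 𝓘(ℝ, E) σ (φ (-T) y) - extChartAt 𝓘(ℝ, E) σ σ))
  rw [norm_sub_rev] at hrev
  -- Halving against drift: `‖Q z‖ / 2 ≤ ‖z‖ / 8 ≤ ‖Q z‖ / 4`, so `Q z = 0`, and the cone gives `z =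
  -- 0`.
  have hz0 : ‖z‖ ≤ 0 := by linarith [norm_nonneg z]
  apply hyσ
  refine (extChartAt 𝓘(ℝ, E) σ).injOn ?_ (mem_extChartAt_source σ)
    (sub_eq_zero.1 (norm_le_zero_iff.1 hz0))
  simpa using (hyW 0 le_rfl).2
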